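/- Let $n$ be a natural number, $P\in\mathbb R^{n\times n}$ a symmetric matrix, $P=P^\top$, with $P_{ij}\in[0,1]$ and $P_{ii}=0$ for all $i,j$, let $a\in\mathbb R\setminus\{0\}$ and $b\in\mathbb R^n$, and suppose that $a\,\mu<1$ for every eigenvalue $\mu$ of $P+P^\top$. Consider the quadratic network game in which the (intervention-free) payoff of player $i$ at the action profile $x\in\mathbb R^n$ is $$W_i(x)=-\tfrac12 x_i^2+x_i\Big(a\sum_{j:\,P_{ij}>0}P_{ij}x_j+b_i\Big),$$ and call a maximizer over $\mathbb R^n$ of the social welfare $\sum_i W_i$ a social optimum. Consider the pseudo-gradient dynamics of the players with intervention $u(t)\in\mathbb R^n$, $$\dot x=(-I+aP)x+b+u,$$ interconnected with the adaptive feedback intervention $$u=Kx,\qquad \dot z=-z+Kx+b+u,\qquad \dot w=-w+e\,x^\top x,\qquad \dot K=e\,x^\top,\qquad e:=x-z-w,$$ where $x(t),z(t),w(t)\in\mathbb R^n$ and $K(t)\in\mathbb R^{n\times n}$. Then there is a unique social optimum $x_{\mathrm{opt}}$; for every initial condition $(x(0),z(0),w(0),K(0))$ the closed-loop system has a solution on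 $[0,\infty)$; and along every solution of the closed-loop system on $[0,\infty)$, whatever its initial condition, the action profile converges to the social optimum: $x(t)\to x_{\mathrm{opt}}$ as $t\to\infty$. -/

import Mathlib

open Filter Topology Matrix

namespace NetworkGame

variable {n : ℕ}

/-- The set of neighbours of player `i`: those `j` with `P i j > 0`. -/
noncomputable def neighbors (P : Matrix (Fin n) (Fin n) ℝ) (i : Fin n) : Finset (Fin n) :=
  Finset.univ.filter fun j => 0 < P i j

/-- The aggregate action of the neighbours of player `i` at the action profile `x`. -/
noncomputable def aggregate (P : Matrix (Fin n) (Fin n) ℝ) (x : Fin n → ℝ) (i : Fin n) : ℝ :=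
  ∑ j ∈ neighbors P i, P i j * x j

/-- The intervention-free payoff of player `i` at the action profile `x`. -/
noncomputable def payoff (P : Matrix (Fin n) (Fin n) ℝ) (a : ℝ) (b : Fin n → ℝ)
    (x : Fin n → ℝ) (i : Fin n) : ℝ :=
  -(1 / 2) * x i ^ 2 + x i * (a * aggregate P x i + b i)

/-- The social welfare: the sum of the intervention-free payoffs of all players. -/
noncomputable def welfare (P : Matrix (Fin n) (Fin n) ℝ) (a : ℝ) (b : Fin n → ℝ)
    (x : Fin n → ℝ) : ℝ :=
  ∑ i, payoff P a b x i

/-- `x` is a social optimum (unconstrained actions): it maximizes the social welfare over all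
action profiles. -/
def IsSocialOptimum (P : Matrix (Fin n) (Fin n) ℝ) (a : ℝ) (b : Fin n → ℝ)
    (x : Fin n → ℝ) : Prop :=
  ∀ y : Fin n → ℝ, welfare P a b y ≤ welfare P a b x

/-- `a * μ < 1` for every eigenvalue `μ` of `P + Pᵀ`. -/
def SpectralCondition (P : Matrix (Fin n) (Fin n) ℝ) (a : ℝ) : Prop :=
  ∀ μ : ℝ, Module.End.HasEigenvalue (Matrix.toLin' (P + Pᵀ)) μ → a * μ < 1

/-- `(x, u)` satisfies the pseudo-gradient dynamics `x' = (-I + aP) x + b + u` on `[0, ∞)`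
(one-sided derivative at `0`). -/
def PseudoGradientDynamics (P : Matrix (Fin n) (Fin n) ℝ) (a : ℝ) (b : Fin n → ℝ)
    (x u : ℝ → Fin n → ℝ) : Prop :=
  ∀ t : ℝ, 0 ≤ t →
    HasDerivWithinAt x ((-1 + a • P) *ᵥ x t + b + u t) (Set.Ici 0) t

/-- `(x, u, z, w, K)` satisfies on `[0, ∞)` the equations of the adaptive feedback intervention,
which depend on the vector `b` but neither on `P` nor on `a`. -/
structure AdaptiveIntervention (b : Fin n → ℝ) (x u z w : ℝ → Fin n → ℝ)
    (K : ℝ → Matrix (Fin n) (Fin n) ℝ) : Prop where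
  /-- `u = K x`. -/
  feedback : ∀ t : ℝ, 0 ≤ t → u t = K t *ᵥ x t
  /-- `z' = -z + K x + b + u`. -/
  deriv_z : ∀ t : ℝ, 0 ≤ t →
    HasDerivWithinAt z (-z t + K t *ᵥ x t + b + u t) (Set.Ici 0) t
  /-- `w' = -w + e xᵀ x` with `e = x - z - w`. -/
  deriv_w : ∀ t : ℝ, 0 ≤ t →
    HasDerivWithinAt w (-w t + (x t ⬝ᵥ x t) • (x t - z t - w t)) (Set.Ici 0) t
  /-- `K' = e xᵀ` with `e = x - z - w`, entry by entry. -/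
  deriv_K : ∀ t : ℝ, 0 ≤ t → ∀ i j : Fin n,
    HasDerivWithinAt (fun s => K s i j) (Matrix.vecMulVec (x t - z t - w t) (x t) i j)
      (Set.Ici 0) t

/-- `(x, u, z, w, K)` is a solution on `[0, ∞)` of the closed loop formed by the pseudo-gradient
dynamics and the adaptive feedback intervention. -/
def IsClosedLoopSolution (P : Matrix (Fin n) (Fin n) ℝ) (a : ℝ) (b : Fin n → ℝ)
    (x u z w : ℝ → Fin n → ℝ) (K : ℝ → Matrix (Fin n) (Fin n) ℝ) : Prop :=
  PseudoGradientDynamics P a b x u ∧ AdaptiveIntervention b x u z w K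

end NetworkGame

/-!
Put `A = 1 - 2 a P`, the negated Hessian of the welfare. As `P` is symmetric, the spectral condition
says that `A` is coercive (`SpectralCondition.exists_coercive`), so the welfare is strictly concave
and its only maximizer is the solution `c` of `A c = b` (`isSocialOptimum_iff_eq`).

Along the closed loop the error `e = x - z - w` satisfies `e' = -(1 + |x|²) e - (K - a P) x`, and
`K' = e xᵀ`, so the energy `|e|² + ‖K - a P‖²` (Frobenius norm) has derivative `-2 m` with
`m = (1 + |x|²) |e|²`: it is bounded, and `m` is integrable. In the sum `x + e` the unknown gain
cancels: `y = x + e - c` satisfies `y' = -A y + (A - 1) e - |x|² e`. Coercivity and Young's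
inequality give `(|y|²)' ≤ -lam |y|² + C m (1 + |y|²)` (`deviation_rate_le`). Hence
`log (1 + |y|²) + (C / 2) * energy` is nonincreasing, which bounds `y`, and then
`(|y|²)' ≤ -lam |y|² + C' m` with `m` integrable, which forces `y → 0`; similarly `|e|⁴ → 0`.
The step from the differential inequality to the limit is `tendsto_zero_of_deriv_add_le`, where the
integrability of `m` is expressed through the energy. Therefore `x = y - e + c → c`.

For global existence the polynomial vector field is multiplied by a smooth cut-off, which makes it
complete (`exists_hasDerivAt_of_hasCompactSupport`). All the differential inequalities above, and
one more for `|z|²`, survive multiplication of the vector field by a nonnegative scalar, so the a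
priori bounds (`IsScaledSolution.exists_bound`) hold for the cut-off system with constants that do
not depend on the cut-off. When the cut-off is `1` on a large enough ball, its solution therefore
solves the closed loop.
-/

namespace NetworkGame

variable {n : ℕ}

/-! ### Completeness of compactly supported vector fields -/

/-- A compactly supported `C¹` vector field on a Banach space is complete. -/
theorem exists_hasDerivAt_of_hasCompactSupport {E : Type*} [NormedAddCommGroup E]
    [NormedSpace ℝ E] [CompleteSpace E] {v : E → E} (hv : ContDiff ℝ 1 v)
    (hs : HasCompactSupport v) (x₀ : E) :
    ∃ γ : ℝ → E, γ 0 = x₀ ∧ ∀ t, HasDerivAt γ (v (γ t)) t := by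
  obtain ⟨K, hK⟩ := ContDiff.lipschitzWith_of_hasCompactSupport hs hv one_ne_zero
  obtain ⟨C, hC⟩ := hs.exists_bound_of_continuous hv.continuous
  have hC0 : 0 ≤ C := (norm_nonneg _).trans (hC x₀)
  lift C to NNReal using hC0
  -- `v` is bounded by `C`, so on a ball of radius `C` the solutions from any point last for time `1`
  have key : ∀ x : E, ∃ γ : ℝ → E, γ 0 = x ∧
      IsMIntegralCurveOn (I := modelWithCornersSelf ℝ E) γ v (Set.Ioo (-1) 1) := by
    intro x
    have hpl : IsPicardLindelof (fun _ => v) (tmin := -1) (tmax := 1) ⟨0, by simp⟩ x C 0 C K :=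
      IsPicardLindelof.of_time_independent (fun y _ => hC y) hK.lipschitzOnWith (by simp)
    obtain ⟨γ, h0, hγ⟩ := hpl.exists_eq_forall_mem_Icc_hasDerivWithinAt₀
    refine ⟨γ, h0, fun t ht => ?_⟩
    have h := ((hγ t (Set.Ioo_subset_Icc_self ht)).mono Set.Ioo_subset_Icc_self).hasFDerivWithinAt
    exact h.hasMFDerivWithinAt
  obtain ⟨γ, h0, hγ⟩ := exists_isMIntegralCurve_of_isMIntegralCurveOn
    (I := modelWithCornersSelf ℝ E) (v := v)
    (contMDiff_vectorSpace_iff_contDiff.2 hv) one_pos key x₀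
  refine ⟨γ, h0, fun t => hasDerivAt_iff_hasFDerivAt.2 ?_⟩
  exact (hγ t).hasFDerivAt

/-! ### Differential inequalities on a half-line -/

theorem antitoneOn_Ici_of_hasDerivWithinAt_nonpos {f f' : ℝ → ℝ} {c : ℝ}
    (hf : ∀ t, c ≤ t → HasDerivWithinAt f (f' t) (Set.Ici c) t) (hf' : ∀ t, c ≤ t → f' t ≤ 0) :
    AntitoneOn f (Set.Ici c) := by
  have hd : ∀ t ∈ interior (Set.Ici c), HasDerivAt f (f' t) t := fun t ht => by
    rw [interior_Ici, Set.mem_Ioi] at ht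
    exact (hf t ht.le).hasDerivAt (Ici_mem_nhds ht)
  refine antitoneOn_of_deriv_nonpos (convex_Ici c) (fun t ht => (hf t ht).continuousWithinAt)
    (fun t ht => (hd t ht).differentiableAt.differentiableWithinAt) fun t ht => ?_
  rw [(hd t ht).deriv]
  exact hf' t (interior_subset ht)

theorem exists_tendsto_of_antitoneOn_Ici {f : ℝ → ℝ} {c B : ℝ} (hf : AntitoneOn f (Set.Ici c))
    (hB : ∀ t, c ≤ t → B ≤ f t) : ∃ L, Tendsto f atTop (𝓝 L) := by
  have h : Antitone fun t => f (max c t) := fun s t hst =>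
    hf (le_max_left c s) (le_max_left c t) (max_le_max le_rfl hst)
  refine ⟨_, (tendsto_atTop_ciInf h ⟨B, ?_⟩).congr' ?_⟩
  · rintro _ ⟨t, rfl⟩
    exact hB _ (le_max_left _ _)
  · filter_upwards [eventually_ge_atTop c] with t ht
    rw [max_eq_right ht]

/-- A Barbalat-type lemma: `r' ≤ -lam * r - c * S'` with `S ≥ 0` nonincreasing forces the
nonnegative function `r` to vanish at infinity. Both `S` and `r + c * S` converge, hence so does
`r`, and a positive limit would make `r + c * S` decrease to `-∞`. -/
theorem tendsto_zero_of_deriv_add_le {r S r' S' : ℝ → ℝ} {c lam : ℝ} (hc : 0 ≤ c) (hlam : 0 < lam)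
    (hr : ∀ t, 0 ≤ t → HasDerivWithinAt r (r' t) (Set.Ici 0) t)
    (hS : ∀ t, 0 ≤ t → HasDerivWithinAt S (S' t) (Set.Ici 0) t)
    (hr0 : ∀ t, 0 ≤ t → 0 ≤ r t) (hS0 : ∀ t, 0 ≤ t → 0 ≤ S t) (hS' : ∀ t, 0 ≤ t → S' t ≤ 0)
    (h : ∀ t, 0 ≤ t → r' t + c * S' t ≤ -(lam * r t)) : Tendsto r atTop (𝓝 0) := by
  have hH : ∀ t, 0 ≤ t →
      HasDerivWithinAt (fun s => r s + c * S s) (r' t + c * S' t) (Set.Ici 0) t :=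
    fun t ht => (hr t ht).add ((hS t ht).const_mul c)
  have hH0 : ∀ t, 0 ≤ t → 0 ≤ r t + c * S t := fun t ht =>
    add_nonneg (hr0 t ht) (mul_nonneg hc (hS0 t ht))
  obtain ⟨L₁, hL₁⟩ := exists_tendsto_of_antitoneOn_Ici
    (antitoneOn_Ici_of_hasDerivWithinAt_nonpos hS hS') hS0
  obtain ⟨L₂, hL₂⟩ := exists_tendsto_of_antitoneOn_Ici
    (antitoneOn_Ici_of_hasDerivWithinAt_nonpos hH fun t ht =>
      (h t ht).trans (neg_nonpos.2 (mul_nonneg hlam.le (hr0 t ht)))) hH0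
  have hL : Tendsto r atTop (𝓝 (L₂ - c * L₁)) := by
    simpa using hL₂.sub (hL₁.const_mul c)
  set L := L₂ - c * L₁
  have hLnn : 0 ≤ L := ge_of_tendsto hL ((eventually_ge_atTop 0).mono hr0)
  rcases hLnn.eq_or_lt with h0 | hpos
  · rwa [← h0] at hL
  exfalso
  obtain ⟨T, hT⟩ := eventually_atTop.1 ((hL.eventually (lt_mem_nhds (half_lt_self hpos))).and
    (eventually_ge_atTop 0))
  have hT0 : 0 ≤ T := (hT T le_rfl).2
  set k := lam * (L / 2) with hk
  have hkpos : 0 < k := by positivity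
  have hanti : AntitoneOn (fun s => (r s + c * S s) + k * s) (Set.Ici T) := by
    refine antitoneOn_Ici_of_hasDerivWithinAt_nonpos (f' := fun t => (r' t + c * S' t) + k * 1)
      (fun t ht => ?_) fun t ht => ?_
    · exact ((hH t (hT0.trans ht)).mono (Set.Ici_subset_Ici.2 hT0)).add
        ((hasDerivWithinAt_id t _).const_mul k)
    · have h1 := h t (hT0.trans ht)
      have h2 := mul_le_mul_of_nonneg_left (hT t ht).1.le hlam.le
      linarith
  -- at this time the linear bound on `r + c * S` has become negative
  set t := T + (r T + c * S T + 1) / k with ht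
  have htT : T ≤ t := by
    have := div_nonneg (add_nonneg (hH0 T hT0) zero_le_one) hkpos.le
    linarith
  have h1 := hanti Set.self_mem_Ici htT htT
  have h2 : k * t = k * T + (r T + c * S T + 1) := by
    rw [ht, mul_add, mul_div_cancel₀ _ hkpos.ne']
  have h3 := hH0 t (hT0.trans htT)
  simp only at h1
  linarith

/-- If `f' ≤ χ * (C - f)` with a rate `χ ≥ 0`, which may vanish, then `f` never exceeds
`max (f 0) C`. -/
theorem le_max_of_deriv_le_mul_sub {f f' χ : ℝ → ℝ} {C : ℝ}
    (hf : ∀ t, 0 ≤ t → HasDerivWithinAt f (f' t) (Set.Ici 0) t) (hχ : ∀ t, 0 ≤ t → 0 ≤ χ t)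
    (h : ∀ t, 0 ≤ t → f' t ≤ χ t * (C - f t)) {t : ℝ} (ht : 0 ≤ t) : f t ≤ max (f 0) C := by
  -- compare with the strict supersolutions `s ↦ max (f 0) C + ε * s`
  have key : ∀ ε > 0, f t ≤ max (f 0) C + ε * t := by
    intro ε hε
    refine image_le_of_deriv_right_lt_deriv_boundary (f := f) (f' := f') (a := 0) (b := t)
      (B := fun s => max (f 0) C + ε * s) (B' := fun _ => ε)
      (fun s hs => (hf s hs.1).continuousWithinAt.mono Set.Icc_subset_Ici_self)
      (fun s hs => (hf s hs.1).mono (Set.Ici_subset_Ici.2 hs.1)) (by simp)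
      (fun s => by simpa using ((hasDerivAt_id s).const_mul ε).const_add (max (f 0) C))
      (fun s hs hfs => ?_) ⟨ht, le_rfl⟩
    have h1 : C - f s ≤ 0 := by
      have := le_max_right (f 0) C
      have := mul_nonneg hε.le hs.1
      linarith
    exact ((h s hs.1).trans (mul_nonpos_of_nonneg_of_nonpos (hχ s hs.1) h1)).trans_lt hε
  refine le_of_forall_pos_le_add fun δ hδ => ?_
  have ht1 : 0 < t + 1 := by linarith
  refine (key (δ / (t + 1)) (by positivity)).trans ?_
  gcongr
  rw [div_mul_eq_mul_div, div_le_iff₀ ht1]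
  nlinarith


/-! ### Dot products and the Frobenius norm -/

theorem zero_le_dotProduct_self (v : Fin n → ℝ) : 0 ≤ v ⬝ᵥ v :=
  Finset.sum_nonneg fun i _ => mul_self_nonneg (v i)

theorem dotProduct_sq_le (u v : Fin n → ℝ) : (u ⬝ᵥ v) ^ 2 ≤ (u ⬝ᵥ u) * (v ⬝ᵥ v) := by
  simpa [dotProduct, pow_two] using Finset.sum_mul_sq_le_sq_mul_sq Finset.univ u v

/-- Young's inequality with weight `c`. -/
theorem two_mul_dotProduct_le (u v : Fin n → ℝ) {c : ℝ} (hc : 0 < c) :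
    2 * (u ⬝ᵥ v) ≤ c * (u ⬝ᵥ u) + c⁻¹ * (v ⬝ᵥ v) := by
  have h := zero_le_dotProduct_self (c • u - v)
  have h1 : (c • u - v) ⬝ᵥ (c • u - v) = c * (c * (u ⬝ᵥ u) + c⁻¹ * (v ⬝ᵥ v) - 2 * (u ⬝ᵥ v)) := by
    simp only [sub_dotProduct, dotProduct_sub, smul_dotProduct, dotProduct_smul, smul_eq_mul,
      dotProduct_comm v u]
    field_simp
    ring
  rw [h1] at h
  linarith [nonneg_of_mul_nonneg_right h hc]

theorem dotProduct_self_add_le (u v : Fin n → ℝ) :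
    (u + v) ⬝ᵥ (u + v) ≤ 2 * (u ⬝ᵥ u) + 2 * (v ⬝ᵥ v) := by
  have h := two_mul_dotProduct_le u v one_pos
  simp only [add_dotProduct, dotProduct_add, dotProduct_comm v u]
  linarith

/-- The squared Frobenius norm of a matrix. -/
noncomputable def frobeniusSq (M : Matrix (Fin n) (Fin n) ℝ) : ℝ :=
  ∑ i, M i ⬝ᵥ M i

theorem frobeniusSq_nonneg (M : Matrix (Fin n) (Fin n) ℝ) : 0 ≤ frobeniusSq M :=
  Finset.sum_nonneg fun i _ => zero_le_dotProduct_self (M i)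

theorem frobeniusSq_add_le (M N : Matrix (Fin n) (Fin n) ℝ) :
    frobeniusSq (M + N) ≤ 2 * frobeniusSq M + 2 * frobeniusSq N := by
  simp only [frobeniusSq, Finset.mul_sum, ← Finset.sum_add_distrib]
  exact Finset.sum_le_sum fun i _ => dotProduct_self_add_le (M i) (N i)

theorem mulVec_dotProduct_self_le (M : Matrix (Fin n) (Fin n) ℝ) (v : Fin n → ℝ) :
    (M *ᵥ v) ⬝ᵥ (M *ᵥ v) ≤ frobeniusSq M * (v ⬝ᵥ v) := by
  rw [frobeniusSq, Finset.sum_mul]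
  refine Finset.sum_le_sum fun i _ => ?_
  rw [← pow_two]
  exact dotProduct_sq_le (M i) v

theorem sq_apply_le_dotProduct_self (v : Fin n → ℝ) (i : Fin n) : v i ^ 2 ≤ v ⬝ᵥ v := by
  rw [pow_two]
  exact Finset.single_le_sum (f := fun i => v i * v i) (fun j _ => mul_self_nonneg (v j))
    (Finset.mem_univ i)

theorem sq_apply_le_frobeniusSq (M : Matrix (Fin n) (Fin n) ℝ) (i j : Fin n) :
    M i j ^ 2 ≤ frobeniusSq M :=
  (sq_apply_le_dotProduct_self (M i) j).trans
    (Finset.single_le_sum (f := fun i => M i ⬝ᵥ M i) (fun k _ => zero_le_dotProduct_self (M k))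
      (Finset.mem_univ i))

theorem hasDerivWithinAt_dotProduct_self {v : ℝ → Fin n → ℝ} {v' : Fin n → ℝ} {s : Set ℝ} {t : ℝ}
    (h : HasDerivWithinAt v v' s t) :
    HasDerivWithinAt (fun τ => v τ ⬝ᵥ v τ) (2 * (v t ⬝ᵥ v')) s t := by
  have h' := hasDerivWithinAt_pi.1 h
  refine (HasDerivWithinAt.fun_sum fun i (_ : i ∈ Finset.univ) =>
    (h' i).mul (h' i)).congr_deriv ?_
  rw [dotProduct, Finset.mul_sum]
  exact Finset.sum_congr rfl fun i _ => by ring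

/-! ### The social optimum -/

/-- The spectral condition makes the quadratic form of `1 - 2 a P`, the negated Hessian of the
welfare, coercive. -/
theorem SpectralCondition.exists_coercive {P : Matrix (Fin n) (Fin n) ℝ} {a : ℝ} (ha : a ≠ 0)
    (hsymm : P = Pᵀ) (hspec : SpectralCondition P a) :
    ∃ lam : ℝ, 0 < lam ∧
      ∀ v : Fin n → ℝ, lam * (v ⬝ᵥ v) ≤ v ⬝ᵥ ((1 - (2 * a) • P) *ᵥ v) := by
  have hfin := Module.End.finite_hasEigenvalue (toLin' (P + Pᵀ))
  obtain ⟨lam, hlam, hle⟩ : ∃ lam : ℝ, 0 < lam ∧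
      ∀ μ, Module.End.HasEigenvalue (toLin' (P + Pᵀ)) μ → a * μ ≤ 1 - lam := by
    rcases Set.eq_empty_or_nonempty {μ | Module.End.HasEigenvalue (toLin' (P + Pᵀ)) μ} with h | h
    · exact ⟨1, one_pos, fun μ hμ => absurd hμ (Set.eq_empty_iff_forall_notMem.1 h μ)⟩
    · obtain ⟨μ₀, hμ₀, hmax⟩ := hfin.exists_maximalFor (fun μ => a * μ) _ h
      refine ⟨1 - a * μ₀, sub_pos.2 (hspec μ₀ hμ₀), fun μ hμ => ?_⟩
      rcases le_total (a * μ) (a * μ₀) with h' | h'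
      · linarith
      · linarith [hmax hμ h']
  refine ⟨lam, hlam, fun v => ?_⟩
  -- an eigenvector of `B` is an eigenvector of `P + Pᵀ`, because `a ≠ 0`
  set B : Matrix (Fin n) (Fin n) ℝ := (1 - (2 * a) • P) - lam • 1 with hB
  have hBh : B.IsHermitian := by
    rw [IsHermitian, conjTranspose_eq_transpose_of_trivial, hB]
    simp [← hsymm]
  have hps : B.PosSemidef := by
    rw [hBh.posSemidef_iff_eigenvalues_nonneg]
    intro i
    set ν := hBh.eigenvalues i
    set w : Fin n → ℝ := ⇑(hBh.eigenvectorBasis i) with hw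
    have hw0 : w ≠ 0 := fun h0 =>
      hBh.eigenvectorBasis.toBasis.ne_zero i (by ext j; simpa using congrFun h0 j)
    have hBw : B *ᵥ w = ν • w := hBh.mulVec_eigenvectorBasis i
    have hPw : a • ((P + Pᵀ) *ᵥ w) = (1 - lam - ν) • w := by
      have : B *ᵥ w = w - a • ((P + Pᵀ) *ᵥ w) - lam • w := by
        rw [hB, ← hsymm, ← two_smul ℝ P]
        simp only [sub_mulVec, smul_mulVec, one_mulVec, smul_smul, mul_comm]
      rw [hBw] at this
      rw [sub_smul, sub_smul, one_smul, this]
      abel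
    have hev : Module.End.HasEigenvalue (toLin' (P + Pᵀ)) (a⁻¹ * (1 - lam - ν)) := by
      refine Module.End.hasEigenvalue_of_hasEigenvector (x := w)
        ⟨Module.End.mem_eigenspace_iff.2 ?_, hw0⟩
      rw [toLin'_apply, mul_smul, ← hPw, smul_smul, inv_mul_cancel₀ ha, one_smul]
    have := hle _ hev
    rw [mul_inv_cancel_left₀ ha] at this
    show 0 ≤ ν
    linarith
  have h := hps.dotProduct_mulVec_nonneg v
  rw [hB, sub_mulVec, smul_mulVec, one_mulVec, dotProduct_sub, dotProduct_smul] at h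
  simpa using h

theorem aggregate_eq_mulVec {P : Matrix (Fin n) (Fin n) ℝ} (hP : ∀ i j, P i j ∈ Set.Icc (0 : ℝ) 1)
    (x : Fin n → ℝ) (i : Fin n) : aggregate P x i = (P *ᵥ x) i := by
  rw [aggregate, neighbors, Finset.sum_filter, mulVec, dotProduct]
  refine Finset.sum_congr rfl fun j _ => ?_
  split_ifs with h
  · rfl
  · rw [le_antisymm (not_lt.1 h) (hP i j).1, zero_mul]

theorem welfare_eq {P : Matrix (Fin n) (Fin n) ℝ} (hP : ∀ i j, P i j ∈ Set.Icc (0 : ℝ) 1)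
    (a : ℝ) (b x : Fin n → ℝ) :
    welfare P a b x = x ⬝ᵥ b - 1 / 2 * (x ⬝ᵥ ((1 - (2 * a) • P) *ᵥ x)) := by
  have h : (1 - (2 * a) • P) *ᵥ x = x - (2 * a) • (P *ᵥ x) := by
    rw [sub_mulVec, smul_mulVec, one_mulVec]
  simp only [welfare, payoff, aggregate_eq_mulVec hP, h, dotProduct, Finset.mul_sum,
    ← Finset.sum_sub_distrib, Pi.sub_apply, Pi.smul_apply, smul_eq_mul]
  exact Finset.sum_congr rfl fun i _ => by ring

/-- Completing the square at the critical point of the welfare. -/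
theorem welfare_eq_sub {P : Matrix (Fin n) (Fin n) ℝ} (hP : ∀ i j, P i j ∈ Set.Icc (0 : ℝ) 1)
    {a : ℝ} {b c : Fin n → ℝ} (hsymm : P = Pᵀ) (hc : (1 - (2 * a) • P) *ᵥ c = b)
    (y : Fin n → ℝ) :
    welfare P a b y = welfare P a b c -
      1 / 2 * ((y - c) ⬝ᵥ ((1 - (2 * a) • P) *ᵥ (y - c))) := by
  have hA : (1 - (2 * a) • P)ᵀ = 1 - (2 * a) • P := by simp [← hsymm]
  have hcomm : c ⬝ᵥ ((1 - (2 * a) • P) *ᵥ y) = y ⬝ᵥ b := by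
    rw [dotProduct_mulVec, ← mulVec_transpose, hA, hc, dotProduct_comm]
  rw [welfare_eq hP, welfare_eq hP, mulVec_sub, hc]
  simp only [sub_dotProduct, dotProduct_sub, hcomm]
  ring

/-- The critical point of the welfare is the unique social optimum. -/
theorem isSocialOptimum_iff_eq {P : Matrix (Fin n) (Fin n) ℝ}
    (hP : ∀ i j, P i j ∈ Set.Icc (0 : ℝ) 1) {a lam : ℝ} {b c : Fin n → ℝ} (hsymm : P = Pᵀ)
    (hc : (1 - (2 * a) • P) *ᵥ c = b) (hlam : 0 < lam)
    (hcoer : ∀ v : Fin n → ℝ, lam * (v ⬝ᵥ v) ≤ v ⬝ᵥ ((1 - (2 * a) • P) *ᵥ v)) (y : Fin n → ℝ) :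
    IsSocialOptimum P a b y ↔ y = c := by
  constructor
  · intro h
    have h1 := h c
    rw [welfare_eq_sub hP hsymm hc y] at h1
    have h2 := hcoer (y - c)
    have h3 := zero_le_dotProduct_self (y - c)
    have h4 : (y - c) ⬝ᵥ (y - c) = 0 := by nlinarith
    exact sub_eq_zero.1 (dotProduct_self_eq_zero.1 h4)
  · rintro rfl z
    rw [welfare_eq_sub hP hsymm hc z]
    have := mul_nonneg hlam.le (zero_le_dotProduct_self (z - y))
    linarith [hcoer (z - y)]

theorem exists_mulVec_eq_of_coercive {A : Matrix (Fin n) (Fin n) ℝ} {lam : ℝ} (hlam : 0 < lam)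
    (hcoer : ∀ v : Fin n → ℝ, lam * (v ⬝ᵥ v) ≤ v ⬝ᵥ (A *ᵥ v)) (b : Fin n → ℝ) :
    ∃ c, A *ᵥ c = b := by
  have hinj : Function.Injective (toLin' A) := by
    rw [← LinearMap.ker_eq_bot, LinearMap.ker_eq_bot']
    intro v hv
    have h := hcoer v
    rw [← toLin'_apply, hv, dotProduct_zero] at h
    have h2 := zero_le_dotProduct_self v
    exact dotProduct_self_eq_zero.1 (by nlinarith)
  obtain ⟨c, hc⟩ := LinearMap.injective_iff_surjective.1 hinj b
  exact ⟨c, hc⟩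

/-! ### Lyapunov functions -/

/-- `(x, z, w, K)` solves on `[0, ∞)` the closed loop whose vector field is multiplied by the
scalar rate `χ t`. The rate `χ = 1` gives the closed loop itself, while a cut-off of the vector
field gives a rate with values in `[0, 1]`. -/
structure IsScaledSolution (P : Matrix (Fin n) (Fin n) ℝ) (a : ℝ) (b : Fin n → ℝ) (χ : ℝ → ℝ)
    (x z w : ℝ → Fin n → ℝ) (K : ℝ → Matrix (Fin n) (Fin n) ℝ) : Prop where
  nonneg : ∀ t : ℝ, 0 ≤ t → 0 ≤ χ t
  deriv_x : ∀ t : ℝ, 0 ≤ t →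
    HasDerivWithinAt x (χ t • ((-1 + a • P) *ᵥ x t + b + K t *ᵥ x t)) (Set.Ici 0) t
  deriv_z : ∀ t : ℝ, 0 ≤ t →
    HasDerivWithinAt z (χ t • (-z t + K t *ᵥ x t + b + K t *ᵥ x t)) (Set.Ici 0) t
  deriv_w : ∀ t : ℝ, 0 ≤ t →
    HasDerivWithinAt w (χ t • (-w t + (x t ⬝ᵥ x t) • (x t - z t - w t))) (Set.Ici 0) t
  deriv_K : ∀ t : ℝ, 0 ≤ t → ∀ i j : Fin n,
    HasDerivWithinAt (fun s => K s i j) (χ t * ((x t - z t - w t) i * x t j)) (Set.Ici 0) t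

/-- The Lyapunov function of the adaptation: the squared error `e = x - z - w` plus the squared
distance of the gain `K` to its target `a P`. -/
noncomputable def energy (P : Matrix (Fin n) (Fin n) ℝ) (a : ℝ) (x z w : Fin n → ℝ)
    (K : Matrix (Fin n) (Fin n) ℝ) : ℝ :=
  (x - z - w) ⬝ᵥ (x - z - w) + frobeniusSq (K - a • P)

/-- The dissipation rate of the energy. -/
noncomputable def dissipation (x z w : Fin n → ℝ) : ℝ :=
  (1 + x ⬝ᵥ x) * ((x - z - w) ⬝ᵥ (x - z - w))

/-- The squared distance of `x + e` to `c`. In the time derivative of `x + e`, with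
`e = x - z - w`, the gain `K` cancels. -/
noncomputable def deviation (c x z w : Fin n → ℝ) : ℝ :=
  (x + (x - z - w) - c) ⬝ᵥ (x + (x - z - w) - c)

theorem dissipation_nonneg (x z w : Fin n → ℝ) : 0 ≤ dissipation x z w :=
  mul_nonneg (add_nonneg zero_le_one (zero_le_dotProduct_self x)) (zero_le_dotProduct_self _)

theorem error_le_dissipation (x z w : Fin n → ℝ) :
    (x - z - w) ⬝ᵥ (x - z - w) ≤ dissipation x z w := by
  have := mul_nonneg (zero_le_dotProduct_self x) (zero_le_dotProduct_self (x - z - w))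
  rw [dissipation]
  linarith

theorem energy_nonneg (P : Matrix (Fin n) (Fin n) ℝ) (a : ℝ) (x z w : Fin n → ℝ)
    (K : Matrix (Fin n) (Fin n) ℝ) : 0 ≤ energy P a x z w K :=
  add_nonneg (zero_le_dotProduct_self _) (frobeniusSq_nonneg _)

theorem error_le_energy (P : Matrix (Fin n) (Fin n) ℝ) (a : ℝ) (x z w : Fin n → ℝ)
    (K : Matrix (Fin n) (Fin n) ℝ) : (x - z - w) ⬝ᵥ (x - z - w) ≤ energy P a x z w K :=
  le_add_of_nonneg_right (frobeniusSq_nonneg _)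

theorem frobeniusSq_le_energy (P : Matrix (Fin n) (Fin n) ℝ) (a : ℝ) (x z w : Fin n → ℝ)
    (K : Matrix (Fin n) (Fin n) ℝ) : frobeniusSq (K - a • P) ≤ energy P a x z w K :=
  le_add_of_nonneg_left (zero_le_dotProduct_self _)

theorem deviation_nonneg (c x z w : Fin n → ℝ) : 0 ≤ deviation c x z w :=
  zero_le_dotProduct_self _

/-- The action is controlled by the deviation and the error, as `x = (x + e - c) + c - e`. -/
theorem action_le (c x z w : Fin n → ℝ) :
    x ⬝ᵥ x ≤ 4 * (deviation c x z w + c ⬝ᵥ c + (x - z - w) ⬝ᵥ (x - z - w)) := by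
  have h1 := dotProduct_self_add_le (x + (x - z - w) - c + c) (-(x - z - w))
  have h2 := dotProduct_self_add_le (x + (x - z - w) - c) c
  have h3 : x + (x - z - w) - c + c + -(x - z - w) = x := by abel
  have h4 := zero_le_dotProduct_self (x - z - w)
  rw [h3, neg_dotProduct_neg] at h1
  rw [deviation]
  linarith

/-- The growth constant of `log (1 + deviation)` against the dissipation, for an energy bounded by
`S₀`. -/
noncomputable def growthConst (A : Matrix (Fin n) (Fin n) ℝ) (lam : ℝ) (c : Fin n → ℝ)
    (S₀ : ℝ) : ℝ :=
  2 / lam * (frobeniusSq (A - 1) + 4 * (1 + c ⬝ᵥ c + S₀))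

theorem growthConst_nonneg (A : Matrix (Fin n) (Fin n) ℝ) {lam S₀ : ℝ} (c : Fin n → ℝ)
    (hlam : 0 < lam) (hS₀ : 0 ≤ S₀) : 0 ≤ growthConst A lam c S₀ := by
  have := frobeniusSq_nonneg (A - 1)
  have := zero_le_dotProduct_self c
  unfold growthConst
  positivity

/-- The error terms in the derivative of the deviation are absorbed by coercivity, up to a multiple
of the dissipation that grows at most linearly in the deviation. -/
theorem deviation_rate_le {A : Matrix (Fin n) (Fin n) ℝ} {lam S₀ : ℝ} (hlam : 0 < lam)
    (hcoer : ∀ v : Fin n → ℝ, lam * (v ⬝ᵥ v) ≤ v ⬝ᵥ (A *ᵥ v)) (c x z w : Fin n → ℝ)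
    (hS : (x - z - w) ⬝ᵥ (x - z - w) ≤ S₀) :
    2 * ((x + (x - z - w) - c) ⬝ᵥ (-(A *ᵥ (x + (x - z - w) - c)) + (A - 1) *ᵥ (x - z - w) -
      (x ⬝ᵥ x) • (x - z - w))) ≤
      -(lam * deviation c x z w) +
        growthConst A lam c S₀ * dissipation x z w * (1 + deviation c x z w) := by
  have hX := action_le c x z w
  have hm := error_le_dissipation x z w
  have hm' : (x ⬝ᵥ x) * ((x - z - w) ⬝ᵥ (x - z - w)) ≤ dissipation x z w := by
    have := zero_le_dotProduct_self (x - z - w)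
    rw [dissipation]
    linarith
  have hm0 := dissipation_nonneg x z w
  have hX0 := zero_le_dotProduct_self x
  have hq0 := deviation_nonneg c x z w
  have hc0 := zero_le_dotProduct_self c
  have he0 := zero_le_dotProduct_self (x - z - w)
  rw [growthConst]
  unfold deviation at hX hq0 ⊢
  generalize dissipation x z w = m at *
  set e := x - z - w
  set y := x + e - c
  have hF0 := frobeniusSq_nonneg (A - 1)
  have h1 := hcoer y
  have h2 := two_mul_dotProduct_le y ((A - 1) *ᵥ e) (half_pos hlam)
  have h3 := two_mul_dotProduct_le y (-((x ⬝ᵥ x) • e)) (half_pos hlam)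
  have h4 := mulVec_dotProduct_self_le (A - 1) e
  have h5 : 2 * (y ⬝ᵥ (-(A *ᵥ y) + (A - 1) *ᵥ e - (x ⬝ᵥ x) • e)) =
      -(2 * (y ⬝ᵥ (A *ᵥ y))) + 2 * (y ⬝ᵥ ((A - 1) *ᵥ e)) + 2 * (y ⬝ᵥ (-((x ⬝ᵥ x) • e))) := by
    simp only [dotProduct_sub, dotProduct_add, dotProduct_neg]
    ring
  have h6 : -((x ⬝ᵥ x) • e) ⬝ᵥ -((x ⬝ᵥ x) • e) = (x ⬝ᵥ x) * ((x ⬝ᵥ x) * (e ⬝ᵥ e)) := by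
    simp only [neg_dotProduct_neg, smul_dotProduct, dotProduct_smul, smul_eq_mul]
  rw [h6] at h3
  have h7 : ((A - 1) *ᵥ e) ⬝ᵥ ((A - 1) *ᵥ e) ≤ frobeniusSq (A - 1) * m * (1 + y ⬝ᵥ y) := by
    refine h4.trans ((mul_le_mul_of_nonneg_left hm hF0).trans ?_)
    exact le_mul_of_one_le_right (mul_nonneg hF0 hm0) (le_add_of_nonneg_right hq0)
  have h8 : (x ⬝ᵥ x) * ((x ⬝ᵥ x) * (e ⬝ᵥ e)) ≤ 4 * (1 + c ⬝ᵥ c + S₀) * m * (1 + y ⬝ᵥ y) := by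
    have hX' : x ⬝ᵥ x ≤ 4 * (1 + c ⬝ᵥ c + S₀) * (1 + y ⬝ᵥ y) := by
      have := mul_nonneg (add_nonneg hc0 (he0.trans hS)) hq0
      linarith
    calc (x ⬝ᵥ x) * ((x ⬝ᵥ x) * (e ⬝ᵥ e))
        ≤ (x ⬝ᵥ x) * m := mul_le_mul_of_nonneg_left hm' hX0
      _ ≤ 4 * (1 + c ⬝ᵥ c + S₀) * (1 + y ⬝ᵥ y) * m := mul_le_mul_of_nonneg_right hX' hm0
      _ = _ := by ring
  have hinv : (lam / 2)⁻¹ = 2 / lam := inv_div _ _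
  rw [hinv] at h2 h3
  have hl : 0 ≤ 2 / lam := by positivity
  have h9 := mul_le_mul_of_nonneg_left (add_le_add h7 h8) hl
  rw [h5]
  linarith

/-! ### A priori bounds -/

namespace IsScaledSolution

variable {P : Matrix (Fin n) (Fin n) ℝ} {a : ℝ} {b : Fin n → ℝ} {χ : ℝ → ℝ}
  {x z w : ℝ → Fin n → ℝ} {K : ℝ → Matrix (Fin n) (Fin n) ℝ} {t : ℝ}

theorem hasDerivWithinAt_error (h : IsScaledSolution P a b χ x z w K) (ht : 0 ≤ t) :
    HasDerivWithinAt (fun s => x s - z s - w s)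
      (χ t • (-((1 + x t ⬝ᵥ x t) • (x t - z t - w t)) - (K t - a • P) *ᵥ x t)) (Set.Ici 0) t := by
  refine (((h.deriv_x t ht).sub (h.deriv_z t ht)).sub (h.deriv_w t ht)).congr_deriv ?_
  rw [← smul_sub, ← smul_sub]
  congr 1
  simp only [add_mulVec, sub_mulVec, neg_mulVec, one_mulVec]
  module

theorem hasDerivWithinAt_frobeniusSq (h : IsScaledSolution P a b χ x z w K) (ht : 0 ≤ t) :
    HasDerivWithinAt (fun s => frobeniusSq (K s - a • P))
      (χ t * (2 * ((x t - z t - w t) ⬝ᵥ ((K t - a • P) *ᵥ x t)))) (Set.Ici 0) t := by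
  have hrow : ∀ i, HasDerivWithinAt (fun s => (K s - a • P) i)
      ((χ t * (x t - z t - w t) i) • x t) (Set.Ici 0) t := fun i => by
    refine hasDerivWithinAt_pi.2 fun j => ?_
    refine ((h.deriv_K t ht i j).sub_const ((a • P) i j)).congr_deriv ?_
    simp only [Pi.smul_apply, smul_eq_mul]
    ring
  refine (HasDerivWithinAt.fun_sum fun i (_ : i ∈ Finset.univ) =>
    hasDerivWithinAt_dotProduct_self (hrow i)).congr_deriv ?_
  rw [dotProduct, Finset.mul_sum, Finset.mul_sum]
  refine Finset.sum_congr rfl fun i _ => ?_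
  rw [dotProduct_smul, smul_eq_mul, mulVec]
  ring

/-- The energy dissipates: the update law of `K` is chosen so that the indefinite terms cancel. -/
theorem hasDerivWithinAt_energy (h : IsScaledSolution P a b χ x z w K) (ht : 0 ≤ t) :
    HasDerivWithinAt (fun s => energy P a (x s) (z s) (w s) (K s))
      (χ t * (-(2 * dissipation (x t) (z t) (w t)))) (Set.Ici 0) t := by
  refine ((hasDerivWithinAt_dotProduct_self (h.hasDerivWithinAt_error ht)).add
    (h.hasDerivWithinAt_frobeniusSq ht)).congr_deriv ?_
  rw [dissipation]
  simp only [dotProduct_smul, dotProduct_sub, dotProduct_neg, smul_eq_mul]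
  ring

theorem hasDerivWithinAt_deviation (h : IsScaledSolution P a b χ x z w K) {c : Fin n → ℝ}
    (hc : (1 - (2 * a) • P) *ᵥ c = b) (ht : 0 ≤ t) :
    HasDerivWithinAt (fun s => deviation c (x s) (z s) (w s))
      (χ t * (2 * ((x t + (x t - z t - w t) - c) ⬝ᵥ
        (-((1 - (2 * a) • P) *ᵥ (x t + (x t - z t - w t) - c)) +
          ((1 - (2 * a) • P) - 1) *ᵥ (x t - z t - w t) -
          (x t ⬝ᵥ x t) • (x t - z t - w t))))) (Set.Ici 0) t := by
  refine (hasDerivWithinAt_dotProduct_self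
    (((h.deriv_x t ht).add (h.hasDerivWithinAt_error ht)).sub_const c)).congr_deriv ?_
  rw [← smul_add, dotProduct_smul, smul_eq_mul, mul_left_comm]
  congr 3
  rw [mulVec_sub, mulVec_add, hc]
  simp only [add_mulVec, sub_mulVec, neg_mulVec, one_mulVec, smul_mulVec]
  module

theorem energy_le (h : IsScaledSolution P a b χ x z w K) (ht : 0 ≤ t) :
    energy P a (x t) (z t) (w t) (K t) ≤ energy P a (x 0) (z 0) (w 0) (K 0) :=
  antitoneOn_Ici_of_hasDerivWithinAt_nonpos (fun _ hs => h.hasDerivWithinAt_energy hs)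
    (fun s hs => mul_nonpos_of_nonneg_of_nonpos (h.nonneg s hs)
      (neg_nonpos.2 (mul_nonneg zero_le_two (dissipation_nonneg _ _ _)))) Set.self_mem_Ici ht ht

theorem deviation_rate_le (h : IsScaledSolution P a b χ x z w K) {lam : ℝ} (hlam : 0 < lam)
    (hcoer : ∀ v : Fin n → ℝ, lam * (v ⬝ᵥ v) ≤ v ⬝ᵥ ((1 - (2 * a) • P) *ᵥ v))
    (c : Fin n → ℝ) (ht : 0 ≤ t) :
    2 * ((x t + (x t - z t - w t) - c) ⬝ᵥ
        (-((1 - (2 * a) • P) *ᵥ (x t + (x t - z t - w t) - c)) +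
          ((1 - (2 * a) • P) - 1) *ᵥ (x t - z t - w t) -
          (x t ⬝ᵥ x t) • (x t - z t - w t))) ≤
      -(lam * deviation c (x t) (z t) (w t)) +
        growthConst (1 - (2 * a) • P) lam c (energy P a (x 0) (z 0) (w 0) (K 0)) *
          dissipation (x t) (z t) (w t) * (1 + deviation c (x t) (z t) (w t)) :=
  NetworkGame.deviation_rate_le hlam hcoer c (x t) (z t) (w t)
    ((error_le_energy P a _ _ _ (K t)).trans (h.energy_le ht))

/-- The deviation stays bounded, because `log (1 + deviation) + C / 2 * energy` is nonincreasing
for the growth constant `C`. -/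
theorem one_add_deviation_le (h : IsScaledSolution P a b χ x z w K) {lam : ℝ} (hlam : 0 < lam)
    (hcoer : ∀ v : Fin n → ℝ, lam * (v ⬝ᵥ v) ≤ v ⬝ᵥ ((1 - (2 * a) • P) *ᵥ v))
    {c : Fin n → ℝ} (hc : (1 - (2 * a) • P) *ᵥ c = b) (ht : 0 ≤ t) :
    1 + deviation c (x t) (z t) (w t) ≤
      Real.exp (Real.log (1 + deviation c (x 0) (z 0) (w 0)) +
        growthConst (1 - (2 * a) • P) lam c (energy P a (x 0) (z 0) (w 0) (K 0)) / 2 *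
          energy P a (x 0) (z 0) (w 0) (K 0)) := by
  set S₀ := energy P a (x 0) (z 0) (w 0) (K 0)
  set C := growthConst (1 - (2 * a) • P) lam c S₀
  have hC : 0 ≤ C := growthConst_nonneg _ c hlam (energy_nonneg _ _ _ _ _ _)
  have hpos : ∀ s, 0 < 1 + deviation c (x s) (z s) (w s) := fun s =>
    add_pos_of_pos_of_nonneg one_pos (deviation_nonneg _ _ _ _)
  have hanti := antitoneOn_Ici_of_hasDerivWithinAt_nonpos
    (fun s hs => (((h.hasDerivWithinAt_deviation hc hs).const_add 1).log (hpos s).ne').add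
      ((h.hasDerivWithinAt_energy hs).const_mul (C / 2))) (fun s hs => ?_) Set.self_mem_Ici ht ht
  · have hE := mul_nonneg (div_nonneg hC zero_le_two)
      (energy_nonneg P a (x t) (z t) (w t) (K t))
    rw [← Real.log_le_iff_le_exp (hpos t)]
    simp only [Pi.add_apply] at hanti
    linarith
  · have hr := h.deviation_rate_le hlam hcoer c hs
    have hq := mul_nonneg hlam.le (deviation_nonneg c (x s) (z s) (w s))
    rw [mul_div_assoc, mul_left_comm, ← mul_add]
    refine mul_nonpos_of_nonneg_of_nonpos (h.nonneg s hs) ?_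
    have : _ / (1 + deviation c (x s) (z s) (w s)) ≤ C * dissipation (x s) (z s) (w s) :=
      (div_le_iff₀ (hpos s)).2 (hr.trans (by linarith))
    linarith

/-- Bound on the filter state `z`, whose equation is driven by `2 K x + b` after substituting
`u = K x`. -/
theorem memory_le (h : IsScaledSolution P a b χ x z w K) {G : ℝ}
    (hG : ∀ t, 0 ≤ t → ((2 : ℝ) • (K t *ᵥ x t) + b) ⬝ᵥ ((2 : ℝ) • (K t *ᵥ x t) + b) ≤ G)
    (ht : 0 ≤ t) : z t ⬝ᵥ z t ≤ max (z 0 ⬝ᵥ z 0) G := by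
  refine le_max_of_deriv_le_mul_sub
    (fun s hs => hasDerivWithinAt_dotProduct_self (h.deriv_z s hs)) h.nonneg (fun s hs => ?_) ht
  have h1 := two_mul_dotProduct_le (z s) ((2 : ℝ) • (K s *ᵥ x s) + b) one_pos
  have h2 : -z s + K s *ᵥ x s + b + K s *ᵥ x s = -z s + ((2 : ℝ) • (K s *ᵥ x s) + b) := by module
  rw [h2, dotProduct_smul, smul_eq_mul, mul_left_comm, dotProduct_add, dotProduct_neg]
  refine mul_le_mul_of_nonneg_left ?_ (h.nonneg s hs)
  rw [inv_one] at h1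
  linarith [hG s hs]

/-- A priori bound, depending on the initial condition but not on the rate `χ`. -/
theorem exists_bound {lam : ℝ} (hlam : 0 < lam)
    (hcoer : ∀ v : Fin n → ℝ, lam * (v ⬝ᵥ v) ≤ v ⬝ᵥ ((1 - (2 * a) • P) *ᵥ v))
    {c : Fin n → ℝ} (hc : (1 - (2 * a) • P) *ᵥ c = b)
    (x₀ z₀ w₀ : Fin n → ℝ) (K₀ : Matrix (Fin n) (Fin n) ℝ) :
    ∃ B : ℝ, ∀ (χ : ℝ → ℝ) (x z w : ℝ → Fin n → ℝ) (K : ℝ → Matrix (Fin n) (Fin n) ℝ),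
      IsScaledSolution P a b χ x z w K → x 0 = x₀ → z 0 = z₀ → w 0 = w₀ → K 0 = K₀ →
      ∀ t, 0 ≤ t → x t ⬝ᵥ x t ≤ B ∧ z t ⬝ᵥ z t ≤ B ∧ w t ⬝ᵥ w t ≤ B ∧ frobeniusSq (K t) ≤ B := by
  -- `S₀` bounds the energy, `Q` the deviation plus one, and `X`, `k`, `Z` the squares of `x`, `K`,
  -- `z`; then `w = x - z - e` is bounded too
  set S₀ := energy P a x₀ z₀ w₀ K₀ with hS₀
  set Q := Real.exp (Real.log (1 + deviation c x₀ z₀ w₀) +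
    growthConst (1 - (2 * a) • P) lam c S₀ / 2 * S₀) with hQ
  set X := 4 * (Q + c ⬝ᵥ c + S₀) with hX
  set k := 2 * S₀ + 2 * frobeniusSq (a • P) with hk
  set G := 8 * (k * X) + 2 * (b ⬝ᵥ b) with hG
  set Z := max (z₀ ⬝ᵥ z₀) G with hZ
  have hS₀0 : 0 ≤ S₀ := energy_nonneg _ _ _ _ _ _
  have hF := frobeniusSq_nonneg (a • P)
  have hk0 : 0 ≤ k := by positivity
  have hX0 : 0 ≤ X := by
    have := zero_le_dotProduct_self c
    have := Real.exp_nonneg (Real.log (1 + deviation c x₀ z₀ w₀) +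
      growthConst (1 - (2 * a) • P) lam c S₀ / 2 * S₀)
    positivity
  have hZ0 : 0 ≤ Z := (zero_le_dotProduct_self z₀).trans (le_max_left _ _)
  refine ⟨4 * X + 4 * Z + 2 * S₀ + k, fun χ x z w K h hx hz hw hK => ?_⟩
  have hbE : ∀ t, 0 ≤ t → energy P a (x t) (z t) (w t) (K t) ≤ S₀ := fun t ht => by
    simpa only [hx, hz, hw, hK] using h.energy_le ht
  have hbX : ∀ t, 0 ≤ t → x t ⬝ᵥ x t ≤ X := fun t ht => by
    have h1 := h.one_add_deviation_le hlam hcoer hc ht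
    simp only [hx, hz, hw, hK] at h1
    have h2 := action_le c (x t) (z t) (w t)
    have h3 := (error_le_energy P a _ _ _ (K t)).trans (hbE t ht)
    rw [← hS₀, ← hQ] at h1
    linarith
  have hbK : ∀ t, 0 ≤ t → frobeniusSq (K t) ≤ k := fun t ht => by
    have h1 := frobeniusSq_add_le (K t - a • P) (a • P)
    rw [sub_add_cancel] at h1
    have h2 := (frobeniusSq_le_energy P a _ _ _ (K t)).trans (hbE t ht)
    linarith
  have hbZ : ∀ t, 0 ≤ t → z t ⬝ᵥ z t ≤ Z := fun t ht => by
    rw [hZ, ← hz]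
    refine h.memory_le (fun s hs => ?_) ht
    refine (dotProduct_self_add_le _ _).trans ?_
    simp only [smul_dotProduct, dotProduct_smul, smul_eq_mul]
    have h1 := mulVec_dotProduct_self_le (K s) (x s)
    have h2 := mul_le_mul (hbK s hs) (hbX s hs) (zero_le_dotProduct_self _) hk0
    linarith
  intro t ht
  have h1 := hbX t ht
  have h2 := hbZ t ht
  have h3 := hbK t ht
  refine ⟨by linarith, by linarith, ?_, by linarith⟩
  have h4 := dotProduct_self_add_le (x t + -z t) (-(x t - z t - w t))
  have h5 := dotProduct_self_add_le (x t) (-z t)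
  have h6 : x t + -z t + -(x t - z t - w t) = w t := by abel
  have h7 := (error_le_energy P a _ _ _ (K t)).trans (hbE t ht)
  rw [h6, neg_dotProduct_neg] at h4
  rw [neg_dotProduct_neg] at h5
  linarith

end IsScaledSolution


/-! ### Convergence to the social optimum -/

theorem tendsto_zero_of_sq_tendsto_zero {f : ℝ → ℝ} (h : Tendsto (fun t => f t ^ 2) atTop (𝓝 0)) :
    Tendsto f atTop (𝓝 0) := by
  rw [tendsto_zero_iff_abs_tendsto_zero]
  simpa [Function.comp_def, Real.sqrt_sq_eq_abs] using (Real.continuous_sqrt.tendsto 0).comp h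

theorem tendsto_zero_of_dotProduct_self {v : ℝ → Fin n → ℝ}
    (h : Tendsto (fun t => v t ⬝ᵥ v t) atTop (𝓝 0)) : Tendsto v atTop (𝓝 0) :=
  tendsto_pi_nhds.2 fun i => tendsto_zero_of_sq_tendsto_zero
    (squeeze_zero (fun t => sq_nonneg (v t i)) (fun t => sq_apply_le_dotProduct_self (v t) i) h)

namespace IsScaledSolution

variable {P : Matrix (Fin n) (Fin n) ℝ} {a : ℝ} {b : Fin n → ℝ}
  {x z w : ℝ → Fin n → ℝ} {K : ℝ → Matrix (Fin n) (Fin n) ℝ}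

theorem tendsto_deviation (h : IsScaledSolution P a b (fun _ => 1) x z w K) {lam : ℝ}
    (hlam : 0 < lam)
    (hcoer : ∀ v : Fin n → ℝ, lam * (v ⬝ᵥ v) ≤ v ⬝ᵥ ((1 - (2 * a) • P) *ᵥ v))
    {c : Fin n → ℝ} (hc : (1 - (2 * a) • P) *ᵥ c = b) :
    Tendsto (fun t => deviation c (x t) (z t) (w t)) atTop (𝓝 0) := by
  obtain ⟨Q, hQ⟩ : ∃ Q, ∀ t, 0 ≤ t → 1 + deviation c (x t) (z t) (w t) ≤ Q :=
    ⟨_, fun t ht => h.one_add_deviation_le hlam hcoer hc ht⟩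
  set C := growthConst (1 - (2 * a) • P) lam c (energy P a (x 0) (z 0) (w 0) (K 0)) with hCdef
  have hC : 0 ≤ C := growthConst_nonneg _ c hlam (energy_nonneg _ _ _ _ _ _)
  have hQ0 : 0 ≤ Q :=
    (add_nonneg zero_le_one (deviation_nonneg _ _ _ _)).trans (hQ 0 le_rfl)
  refine tendsto_zero_of_deriv_add_le (c := C * Q / 2) (by positivity) hlam
    (fun t ht => h.hasDerivWithinAt_deviation hc ht) (fun t ht => h.hasDerivWithinAt_energy ht)
    (fun _ _ => deviation_nonneg _ _ _ _) (fun _ _ => energy_nonneg _ _ _ _ _ _)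
    (fun t _ => ?_) fun t ht => ?_
  · have := dissipation_nonneg (x t) (z t) (w t)
    linarith
  · have h1 := h.deviation_rate_le hlam hcoer c ht
    have h2 := mul_le_mul_of_nonneg_left (hQ t ht)
      (mul_nonneg hC (dissipation_nonneg (x t) (z t) (w t)))
    rw [← hCdef] at h1
    linarith

/-- The error vanishes asymptotically. The square of `e ⬝ᵥ e` is used because the indefinite term
of its derivative, unlike that of `e ⬝ᵥ e` itself, is bounded by the dissipation. -/
theorem tendsto_error (h : IsScaledSolution P a b (fun _ => 1) x z w K) :
    Tendsto (fun t => x t - z t - w t) atTop (𝓝 0) := by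
  refine tendsto_zero_of_dotProduct_self (tendsto_zero_of_sq_tendsto_zero ?_)
  set S₀ := energy P a (x 0) (z 0) (w 0) (K 0) with hS₀def
  have hS₀ : 0 ≤ S₀ := energy_nonneg _ _ _ _ _ _
  refine tendsto_zero_of_deriv_add_le (c := 1 + S₀ ^ 2) (by positivity) zero_lt_four
    (fun t ht => (hasDerivWithinAt_dotProduct_self (h.hasDerivWithinAt_error ht)).pow 2)
    (fun t ht => h.hasDerivWithinAt_energy ht)
    (fun _ _ => sq_nonneg _) (fun _ _ => energy_nonneg _ _ _ _ _ _) (fun t _ => ?_) fun t ht => ?_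
  · have := dissipation_nonneg (x t) (z t) (w t)
    linarith
  · have hE := h.energy_le ht
    have he := (error_le_energy P a (x t) (z t) (w t) (K t)).trans hE
    have hk := (frobeniusSq_le_energy P a (x t) (z t) (w t) (K t)).trans hE
    have hk0 := frobeniusSq_nonneg (K t - a • P)
    have h1 := dotProduct_sq_le (x t - z t - w t) ((K t - a • P) *ᵥ x t)
    have h2 := mulVec_dotProduct_self_le (K t - a • P) (x t)
    rw [dissipation]
    simp only [one_smul, dotProduct_sub (x t - z t - w t) (-_), dotProduct_neg,
      dotProduct_smul, smul_eq_mul]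
    have hX0 := zero_le_dotProduct_self (x t)
    have he0 := zero_le_dotProduct_self (x t - z t - w t)
    generalize (x t - z t - w t) ⬝ᵥ ((K t - a • P) *ᵥ x t) = p at *
    generalize x t ⬝ᵥ x t = X at *
    generalize (x t - z t - w t) ⬝ᵥ (x t - z t - w t) = f at *
    have h3 : p ^ 2 ≤ S₀ ^ 2 * X := by
      calc p ^ 2 ≤ f * (frobeniusSq (K t - a • P) * X) :=
            h1.trans (mul_le_mul_of_nonneg_left h2 he0)
        _ ≤ S₀ * (S₀ * X) := by gcongr
        _ = S₀ ^ 2 * X := by ring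
    -- `-2 p ≤ 1 + p²` makes the bound linear in `X`, hence `f * |p|` a multiple of the dissipation
    have h4 : -(2 * p) ≤ (1 + S₀ ^ 2) * (1 + X) := by
      linarith [sq_nonneg (p + 1), sq_nonneg S₀]
    have h5 := mul_le_mul_of_nonneg_left h4 he0
    have h6 := mul_nonneg hX0 (sq_nonneg f)
    norm_num
    linarith

theorem tendsto_action (h : IsScaledSolution P a b (fun _ => 1) x z w K) {lam : ℝ}
    (hlam : 0 < lam)
    (hcoer : ∀ v : Fin n → ℝ, lam * (v ⬝ᵥ v) ≤ v ⬝ᵥ ((1 - (2 * a) • P) *ᵥ v))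
    {c : Fin n → ℝ} (hc : (1 - (2 * a) • P) *ᵥ c = b) : Tendsto x atTop (𝓝 c) := by
  have h1 := tendsto_zero_of_dotProduct_self (h.tendsto_deviation hlam hcoer hc)
  have h2 := (h1.sub h.tendsto_error).add_const c
  rw [sub_zero, zero_add] at h2
  exact h2.congr fun t => by abel

end IsScaledSolution

theorem IsClosedLoopSolution.isScaledSolution {P : Matrix (Fin n) (Fin n) ℝ} {a : ℝ}
    {b : Fin n → ℝ} {x u z w : ℝ → Fin n → ℝ} {K : ℝ → Matrix (Fin n) (Fin n) ℝ}
    (h : IsClosedLoopSolution P a b x u z w K) : IsScaledSolution P a b (fun _ => 1) x z w K where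
  nonneg _ _ := zero_le_one
  deriv_x t ht := by simpa [h.2.feedback t ht] using h.1 t ht
  deriv_z t ht := by simpa [h.2.feedback t ht] using h.2.deriv_z t ht
  deriv_w t ht := by simpa using h.2.deriv_w t ht
  deriv_K t ht i j := by simpa [vecMulVec_apply] using h.2.deriv_K t ht i j

/-! ### Global existence -/

/-- The states `(x, z, w, K)` of the closed loop. -/
abbrev State (n : ℕ) : Type :=
  (Fin n → ℝ) × (Fin n → ℝ) × (Fin n → ℝ) × (Fin n → Fin n → ℝ)

/-- The vector field of the closed loop, with `u = K x` substituted. -/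
noncomputable def closedLoopField (P : Matrix (Fin n) (Fin n) ℝ) (a : ℝ) (b : Fin n → ℝ)
    (p : State n) : State n :=
  ((-1 + a • P) *ᵥ p.1 + b + of p.2.2.2 *ᵥ p.1,
    -p.2.1 + of p.2.2.2 *ᵥ p.1 + b + of p.2.2.2 *ᵥ p.1,
    -p.2.2.1 + (p.1 ⬝ᵥ p.1) • (p.1 - p.2.1 - p.2.2.1),
    fun i j => (p.1 - p.2.1 - p.2.2.1) i * p.1 j)

theorem contDiff_closedLoopField (P : Matrix (Fin n) (Fin n) ℝ) (a : ℝ) (b : Fin n → ℝ) :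
    ContDiff ℝ 1 (closedLoopField P a b) := by
  have h1 : ContDiff ℝ 1 fun p : State n => (-1 + a • P) *ᵥ p.1 := by
    unfold mulVec dotProduct
    fun_prop
  have h2 : ContDiff ℝ 1 fun p : State n => of p.2.2.2 *ᵥ p.1 := by
    unfold mulVec dotProduct
    simp only [of_apply]
    fun_prop
  have h3 : ContDiff ℝ 1 fun p : State n => p.1 ⬝ᵥ p.1 := by
    unfold dotProduct
    fun_prop
  unfold closedLoopField
  simp only [Pi.sub_apply]
  fun_prop

theorem State.norm_le {p : State n} {B : ℝ} (h1 : p.1 ⬝ᵥ p.1 ≤ B) (h2 : p.2.1 ⬝ᵥ p.2.1 ≤ B)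
    (h3 : p.2.2.1 ⬝ᵥ p.2.2.1 ≤ B) (h4 : frobeniusSq (of p.2.2.2) ≤ B) : ‖p‖ ≤ 1 + B := by
  have hB : 0 ≤ 1 + B := add_nonneg zero_le_one ((zero_le_dotProduct_self _).trans h1)
  -- `|r| ≤ 1 + r²` avoids square roots
  have key : ∀ r : ℝ, r ^ 2 ≤ B → ‖r‖ ≤ 1 + B := fun r hr => by
    rw [Real.norm_eq_abs, abs_le]
    constructor <;> linarith [sq_nonneg (r + 1), sq_nonneg (r - 1), sq_nonneg r]
  have hvec : ∀ v : Fin n → ℝ, v ⬝ᵥ v ≤ B → ‖v‖ ≤ 1 + B := fun v hv =>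
    (pi_norm_le_iff_of_nonneg hB).2 fun i => key _ ((sq_apply_le_dotProduct_self v i).trans hv)
  refine norm_prod_le_iff.2 ⟨hvec _ h1, norm_prod_le_iff.2 ⟨hvec _ h2,
    norm_prod_le_iff.2 ⟨hvec _ h3, ?_⟩⟩⟩
  exact (pi_norm_le_iff_of_nonneg hB).2 fun i => (pi_norm_le_iff_of_nonneg hB).2 fun j =>
    key _ ((sq_apply_le_frobeniusSq (of p.2.2.2) i j).trans h4)

/-- Integral curves of the closed-loop field multiplied by a nonnegative function. -/
theorem isScaledSolution_of_hasDerivAt {P : Matrix (Fin n) (Fin n) ℝ} {a : ℝ} {b : Fin n → ℝ}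
    {γ : ℝ → State n} {χ : ℝ → ℝ} (hχ : ∀ t, 0 ≤ χ t)
    (h : ∀ t, HasDerivAt γ (χ t • closedLoopField P a b (γ t)) t) :
    IsScaledSolution P a b χ (fun t => (γ t).1) (fun t => (γ t).2.1) (fun t => (γ t).2.2.1)
      (fun t => of (γ t).2.2.2) where
  nonneg t _ := hχ t
  deriv_x t _ := by
    have h1 := hasFDerivAt_fst.comp_hasDerivAt t (h t)
    exact h1.hasDerivWithinAt
  deriv_z t _ := by
    have h1 := hasFDerivAt_snd.comp_hasDerivAt t (h t)
    have h2 := hasFDerivAt_fst.comp_hasDerivAt t h1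
    exact h2.hasDerivWithinAt
  deriv_w t _ := by
    have h1 := hasFDerivAt_snd.comp_hasDerivAt t (h t)
    have h2 := hasFDerivAt_snd.comp_hasDerivAt t h1
    have h3 := hasFDerivAt_fst.comp_hasDerivAt t h2
    exact h3.hasDerivWithinAt
  deriv_K t _ i j := by
    have h1 := hasFDerivAt_snd.comp_hasDerivAt t (h t)
    have h2 := hasFDerivAt_snd.comp_hasDerivAt t h1
    have h3 := hasFDerivAt_snd.comp_hasDerivAt t h2
    exact (hasDerivAt_pi.1 (hasDerivAt_pi.1 h3 i) j).hasDerivWithinAt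

/-- Global existence: the closed-loop field is cut off outside a ball that, by the a priori bound,
contains the trajectory of the cut-off field. -/
theorem exists_isClosedLoopSolution {P : Matrix (Fin n) (Fin n) ℝ} {a : ℝ} {b : Fin n → ℝ}
    {lam : ℝ} (hlam : 0 < lam)
    (hcoer : ∀ v : Fin n → ℝ, lam * (v ⬝ᵥ v) ≤ v ⬝ᵥ ((1 - (2 * a) • P) *ᵥ v))
    {c : Fin n → ℝ} (hc : (1 - (2 * a) • P) *ᵥ c = b)
    (x₀ z₀ w₀ : Fin n → ℝ) (K₀ : Matrix (Fin n) (Fin n) ℝ) :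
    ∃ (x u z w : ℝ → Fin n → ℝ) (K : ℝ → Matrix (Fin n) (Fin n) ℝ),
      IsClosedLoopSolution P a b x u z w K ∧ x 0 = x₀ ∧ z 0 = z₀ ∧ w 0 = w₀ ∧ K 0 = K₀ := by
  obtain ⟨B, hB⟩ := IsScaledSolution.exists_bound hlam hcoer hc x₀ z₀ w₀ K₀
  let f : ContDiffBump (0 : State n) :=
    { rIn := max (1 + B) 1
      rOut := max (1 + B) 1 + 1
      rIn_pos := lt_max_of_lt_right one_pos
      rIn_lt_rOut := lt_add_one _ }
  obtain ⟨γ, h0, hγ⟩ := exists_hasDerivAt_of_hasCompactSupport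
    (v := fun p => f p • closedLoopField P a b p)
    (f.contDiff.smul (contDiff_closedLoopField P a b)) f.hasCompactSupport.smul_right
    (x₀, z₀, w₀, fun i j => K₀ i j)
  have hsol := isScaledSolution_of_hasDerivAt (fun t => f.nonneg (x := γ t)) hγ
  have hone : ∀ t, 0 ≤ t → f (γ t) = 1 := fun t ht => by
    obtain ⟨h1, h2, h3, h4⟩ :=
      hB _ _ _ _ _ hsol (by rw [h0]) (by rw [h0]) (by rw [h0]) (by rw [h0]; rfl) t ht
    refine f.one_of_mem_closedBall (mem_closedBall_zero_iff.2 ?_)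
    exact (State.norm_le h1 h2 h3 h4).trans (le_max_left _ _)
  refine ⟨fun t => (γ t).1, fun t => of (γ t).2.2.2 *ᵥ (γ t).1, fun t => (γ t).2.1,
    fun t => (γ t).2.2.1, fun t => of (γ t).2.2.2, ⟨fun t ht => ?_, ⟨fun _ _ => rfl,
    fun t ht => ?_, fun t ht => ?_, fun t ht i j => ?_⟩⟩, by simp [h0], by simp [h0],
    by simp [h0], by ext i j; simp [h0]⟩
  · simpa [hone t ht] using hsol.deriv_x t ht
  · simpa [hone t ht] using hsol.deriv_z t ht
  · simpa [hone t ht] using hsol.deriv_w t ht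
  · simpa [hone t ht, vecMulVec_apply] using hsol.deriv_K t ht i j

end NetworkGame

theorem mainTheorem1 (n : ℕ) (P : Matrix (Fin n) (Fin n) ℝ) (a : ℝ) (b : Fin n → ℝ)
    (hP : ∀ i j, P i j ∈ Set.Icc (0 : ℝ) 1) (hPdiag : ∀ i, P i i = 0) (ha : a ≠ 0)
    (hsymm : P = Pᵀ) (hspec : NetworkGame.SpectralCondition P a) :
    ∃ xopt : Fin n → ℝ,
      (∀ y : Fin n → ℝ, NetworkGame.IsSocialOptimum P a b y ↔ y = xopt) ∧
      (∀ (x₀ z₀ w₀ : Fin n → ℝ) (K₀ : Matrix (Fin n) (Fin n) ℝ),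
        ∃ (x u z w : ℝ → Fin n → ℝ) (K : ℝ → Matrix (Fin n) (Fin n) ℝ),
          NetworkGame.IsClosedLoopSolution P a b x u z w K ∧
          x 0 = x₀ ∧ z 0 = z₀ ∧ w 0 = w₀ ∧ K 0 = K₀) ∧
      (∀ (x u z w : ℝ → Fin n → ℝ) (K : ℝ → Matrix (Fin n) (Fin n) ℝ),
        NetworkGame.IsClosedLoopSolution P a b x u z w K →
          Tendsto x atTop (𝓝 xopt)) := by
  obtain ⟨lam, hlam, hcoer⟩ := hspec.exists_coercive ha hsymm
  obtain ⟨c, hc⟩ := NetworkGame.exists_mulVec_eq_of_coercive hlam hcoer b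
  exact ⟨c, NetworkGame.isSocialOptimum_iff_eq hP hsymm hc hlam hcoer,
    NetworkGame.exists_isClosedLoopSolution hlam hcoer hc,
    fun _ _ _ _ _ h => h.isScaledSolution.tendsto_action hlam hcoer hc⟩
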